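/- Fix $\Lambda\in\mathbb N$. An edge-colored graph $G$ is a finite simple graph $(V(G),E(G))$ with a coloring $c:E(G)\to[\Lambda]$; isomorphisms preserve colors. For $v\in V(G)$ the card $G_v$ is obtained by deleting $v$ and all edges at $v$ and restricting $c$; the deck of $G$ is the multiset of isomorphism types of the cards $G_v$, $v\in V(G)$. Two colored graphs are reconstructions of each other if they have the same deck. An invariant $\mu$ is called reconstructible if $\mu(G)=\mu(H)$ whenever $G$ and $H$ have at least three vertices and are reconstructions of each other. For $A\subseteq E(G)$ let $V(A)$ be the set of vertices covered by $A$, $k(A)$ the number of connected components of $(V(G),A)$, $k_{cov}(A)$ the number of connected components of $(V(A),A)$, $r(A)=|V(G)|-k(A)$ and $n(A)=|A|-r(A)$. **Theorem.** The colored universal edge elimination polynomial $$\xi_{lab}(G;x,z,\bar t)=\sum_{\substack{A,B\subseteq E(G)\\ V(A)\cap V(B)=\emptyset}} x^{k(A\sqcup B)}\Big(\prod_{e\in A\sqcup B}t_{c(e)}\Big)z^{k_{cov}(B)}\in\mathbb Z[x,z,t_1,\dots,t_\Lambda]$$ is reconstructible, and so is its value at any elements $x,z,t_1,\dots,t_\Lambda$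 of any commutative ring. The following polynomials with integer coefficients are reconstructible as well: 1. the colored Sokal polynomial $\sum_{A\subseteq E(G)}q^{k(A)}\prod_{e\in A}v_{c(e)}$ in the indeterminates $q,v_1,\dots,v_\Lambda$; 2. Zaslavsky's normal function of the colored cycle matroid of $G$, $\sum_{A\subseteq E(G)}\prod_{e\in A}b_{c(e)}\prod_{e\in E(G)\setminus A}a_{c(e)}\;u^{r(E(G))-r(A)}v^{n(A)}$, in the indeterminates $u,v,a_1,\dots,a_\Lambda,b_1,\dots,b_\Lambda$; 3. the chain polynomial of Read and Whitehead, $\sum_{Y\subseteq E(G)}F_{E(G)\setminus Y}(1-\omega)\prod_{e\in Y}w_{c(e)}$, in the indeterminates $\omega,w_1,\dots,w_\Lambda$, where $F_S(q)=\sum_{A\subseteq S}(-1)^{|S\setminus A|}q^{n(A)}$ is the flow polynomial of $(V(G),S)$; 4. the multivariate matching polynomial $\sum_{M}x^{|V(G)\setminus V(M)|}\prod_{e\in M}t_{c(e)}$ in the indeterminates $x,t_1,\dots,t_\Lambda$, where $M$ runs over all matchings of $G$. -/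

import Mathlib

/-- A simple graph on the vertex set `V` together with a colouring of its edges by `Λ` colours. -/
structure ColoredGraph (V : Type*) (Λ : ℕ) where
  graph : SimpleGraph V
  color : graph.edgeSet → Fin Λ

universe u w

namespace ColoredGraph

/-- `G.Isom H`: there is a graph isomorphism from `G` to `H` that preserves the colours of
the edges. -/
def Isom {V W : Type*} {Λ : ℕ} (G : ColoredGraph V Λ) (H : ColoredGraph W Λ) : Prop :=
  ∃ φ : G.graph ≃g H.graph, ∀ e : G.graph.edgeSet, H.color (φ.mapEdgeSet e) = G.color e

/-- The card `G_v`: delete the vertex `v` and all edges incident with it, and restrict the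
colouring. -/
def deleteVert {V : Type*} {Λ : ℕ} (G : ColoredGraph V Λ) (v : V) :
    ColoredGraph {w : V // w ≠ v} Λ where
  graph := G.graph.comap (Function.Embedding.subtype fun w => w ≠ v)
  color e := G.color ((SimpleGraph.Embedding.comap
    (Function.Embedding.subtype fun w => w ≠ v) G.graph).mapEdgeSet e)

/-- `H` is a reconstruction of `G`: the two decks, as multisets of isomorphism types of coloured
graphs, agree, that is, the cards can be matched up so that corresponding cards are isomorphic.
(If both graphs live on the same vertex set and `G_v ≅ H_v` for all `v`, take `σ` to be the
identity.) -/
def IsReconstruction {V W : Type*} {Λ : ℕ} (G : ColoredGraph V Λ) (H : ColoredGraph W Λ) : Prop :=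
  ∃ σ : V ≃ W, ∀ v : V, (G.deleteVert v).Isom (H.deleteVert (σ v))

/-- An invariant `μ` of finite edge-coloured graphs is reconstructible if it takes the same value
on any two graphs with at least three vertices that are reconstructions of each other. -/
def Reconstructible {Λ : ℕ} {α : Type w}
    (μ : ∀ (V : Type u) [Fintype V], ColoredGraph V Λ → α) : Prop :=
  ∀ (V W : Type u) [Fintype V] [Fintype W] (G : ColoredGraph V Λ) (H : ColoredGraph W Λ),
    3 ≤ Fintype.card V → IsReconstruction G H → μ V G = μ W H

section EdgeSets

variable {V : Type*} {Λ : ℕ} (G : ColoredGraph V Λ)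

/-- The spanning subgraph `(V(G), A)`. -/
def spanning (A : Finset G.graph.edgeSet) : SimpleGraph V :=
  SimpleGraph.fromEdgeSet {e | ∃ a ∈ A, (a : Sym2 V) = e}

/-- The set `V(A)` of vertices covered by the edges in `A`. -/
def cover (A : Finset G.graph.edgeSet) : Set V :=
  {v | ∃ a ∈ A, v ∈ (a : Sym2 V)}

/-- `k(A)`: the number of connected components of `(V(G), A)`. -/
noncomputable def k (A : Finset G.graph.edgeSet) : ℕ :=
  Nat.card (G.spanning A).ConnectedComponent

/-- `k_cov(A)`: the number of connected components of `(V(A), A)`. -/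
noncomputable def kCov (A : Finset G.graph.edgeSet) : ℕ :=
  Nat.card ((G.spanning A).induce (G.cover A)).ConnectedComponent

/-- `r(A) = |V(G)| - k(A)`, the rank of `A` in the cycle matroid of `G`
(the subtraction never truncates for finite `V`, as `k(A) ≤ |V(G)|`). -/
noncomputable def rank (A : Finset G.graph.edgeSet) : ℕ :=
  Nat.card V - G.k A

/-- `n(A) = |A| - r(A) = |A| - |V(G)| + k(A)`, the nullity of `A`
(the subtraction never truncates, as `r(A) ≤ |A|`). -/
noncomputable def nullity (A : Finset G.graph.edgeSet) : ℕ :=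
  A.card - G.rank A

/-- No two different edges in `A` share a vertex. -/
def IsMatchingSet (A : Finset G.graph.edgeSet) : Prop :=
  ∀ e ∈ A, ∀ f ∈ A, ∀ v : V, v ∈ (e : Sym2 V) → v ∈ (f : Sym2 V) → e = f

end EdgeSets

/-- The indeterminates `x`, `z`, `t_c` of the coloured universal edge elimination polynomial. -/
inductive XiVar (Λ : ℕ)
  | x
  | z
  | t (c : Fin Λ)

/-- The indeterminates `q`, `v_c` of the coloured Sokal polynomial. -/
inductive SokalVar (Λ : ℕ)
  | q
  | v (c : Fin Λ)

/-- The indeterminates `u`, `v`, `a_c`, `b_c` of the normal function of Zaslavsky. -/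
inductive NormalVar (Λ : ℕ)
  | u
  | v
  | a (c : Fin Λ)
  | b (c : Fin Λ)

/-- The indeterminates `ω`, `w_c` of the chain polynomial. -/
inductive ChainVar (Λ : ℕ)
  | ω
  | w (c : Fin Λ)

/-- The indeterminates `x`, `t_c` of the multivariate matching polynomial. -/
inductive MatchingVar (Λ : ℕ)
  | x
  | t (c : Fin Λ)

section Polynomials

open MvPolynomial

variable {V : Type*} [Fintype V] {Λ : ℕ} (G : ColoredGraph V Λ)

open Classical in
/-- The coloured universal edge elimination polynomial
`ξ_lab(G; x, z, t) = ∑ x^{k(A ⊔ B)} (∏_{e ∈ A ⊔ B} t_{c(e)}) z^{k_cov(B)}`,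
the sum being over all pairs of edge sets `A`, `B` with `V(A) ∩ V(B) = ∅`. -/
noncomputable def xiLab : MvPolynomial (XiVar Λ) ℤ :=
  ∑ A : Finset G.graph.edgeSet, ∑ B : Finset G.graph.edgeSet,
    if Disjoint (G.cover A) (G.cover B) then
      X XiVar.x ^ G.k (A ∪ B) * (∏ e ∈ A ∪ B, X (XiVar.t (G.color e))) * X XiVar.z ^ G.kCov B
    else 0

open Classical in
/-- The coloured Sokal polynomial `∑_{A ⊆ E} q^{k(A)} ∏_{e ∈ A} v_{c(e)}`. -/
noncomputable def sokal : MvPolynomial (SokalVar Λ) ℤ :=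
  ∑ A : Finset G.graph.edgeSet, X SokalVar.q ^ G.k A * ∏ e ∈ A, X (SokalVar.v (G.color e))

open Classical in
/-- The normal function of Zaslavsky (the parametrized rank generating polynomial) of the cycle
matroid of `G`, coloured as `G`:
`∑_{A ⊆ E} (∏_{e ∈ A} b_{c(e)}) (∏_{e ∉ A} a_{c(e)}) u^{r(E) - r(A)} v^{n(A)}`. Deleting an edge
`e` has the parameter `a_{c(e)}`, contracting it has the parameter `b_{c(e)}`. -/
noncomputable def normalFunction : MvPolynomial (NormalVar Λ) ℤ :=
  ∑ A : Finset G.graph.edgeSet,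
    (∏ e ∈ A, X (NormalVar.b (G.color e))) * (∏ e ∈ Aᶜ, X (NormalVar.a (G.color e))) *
      X NormalVar.u ^ (G.rank Finset.univ - G.rank A) * X NormalVar.v ^ G.nullity A

open Classical in
/-- The flow polynomial `F_S(q) = ∑_{A ⊆ S} (-1)^{|S \ A|} q^{n(A)}` of the graph `(V(G), S)`,
whose value at a positive integer `q` is the number of nowhere-zero flows with values
in `ℤ/qℤ`. -/
noncomputable def flowPolynomial (S : Finset G.graph.edgeSet) : Polynomial ℤ :=
  ∑ A ∈ S.powerset, (-1) ^ (S \ A).card * Polynomial.X ^ G.nullity A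

open Classical in
/-- The chain polynomial of Read and Whitehead, `∑_{Y ⊆ E} F_{E \ Y}(1 - ω) ∏_{e ∈ Y} w_{c(e)}`,
where `F` denotes the flow polynomial. -/
noncomputable def chainPolynomial : MvPolynomial (ChainVar Λ) ℤ :=
  ∑ Y : Finset G.graph.edgeSet,
    Polynomial.aeval (1 - X ChainVar.ω : MvPolynomial (ChainVar Λ) ℤ) (G.flowPolynomial Yᶜ) *
      ∏ e ∈ Y, X (ChainVar.w (G.color e))

open Classical in
/-- The multivariate matching polynomial: the sum over all matchings `M` of `x` to the number of
vertices not covered by `M`, times `∏_{e ∈ M} t_{c(e)}`. -/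
noncomputable def matchingPolynomial : MvPolynomial (MatchingVar Λ) ℤ :=
  ∑ M : Finset G.graph.edgeSet,
    if G.IsMatchingSet M then
      X MatchingVar.x ^ (G.cover M)ᶜ.ncard * ∏ e ∈ M, X (MatchingVar.t (G.color e))
    else 0

end Polynomials

/-- The value of `ξ_lab(G; x, z, t)` at elements `x`, `z`, `t_c` of a commutative ring. -/
noncomputable def xiLabEval {V : Type*} [Fintype V] {Λ : ℕ} (G : ColoredGraph V Λ)
    {R : Type*} [CommRing R] (x z : R) (t : Fin Λ → R) : R :=
  MvPolynomial.aeval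
    (fun i : XiVar Λ => match i with
      | XiVar.x => x
      | XiVar.z => z
      | XiVar.t c => t c)
    G.xiLab

end ColoredGraph

/-! The isomorphisms of cards, extended by sending each deleted vertex to its partner, give
bijections `V ≃ W`, one for each vertex `v`. Along the bijection of `v`, everything that is read off
an induced subgraph avoiding `v` is preserved. The task is to show that certain functions of vertex
sets, so transported on proper subsets, also agree on the whole vertex set; this is `Agree`.

Kelly's lemma determines the sum of such a function over all proper subsets. Kocay's lemma extends
this to sums of `a S * c Sᶜ` over nonempty proper `S`: multiply the sums of `a` and `c` over sets of
complementary sizes and sort the pairs by their union. Hence agreement is preserved by convolution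
(`Agree.conv`), and by deconvolution with a function that is `1` at `∅` (`Agree.of_conv`).

The product of `1 + t e` over all pairs inside `S` agrees, since the edge colors form a
reconstructible multiset once there are three vertices. Its `q`-fold convolution power is the Potts
partition function (Fortuin–Kasteleyn), which is the Sokal polynomial at `q`; as a polynomial
identity in `q` the agreement extends to an indeterminate. Removing isolated vertices by
deconvolution isolates the edge sets that cover `S`, and `ξ_lab` is the convolution of this covering
part at `x * z` with the Sokal polynomial at `x`. The matching polynomial is a coefficient of
another such convolution. The normal function and the chain polynomial depend only on the joint
distribution of `k(A)` and the color counts of `A`, which the Sokal polynomial records. -/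

/-- A family of bijections `V ≃ W`, one for each vertex `v` of `V`, such that the images of the
distinguished vertices `v` enumerate `W`. -/
structure VertexMatching (V W : Type*) where
  equiv : V → V ≃ W
  bijective : Function.Bijective fun v => equiv v v

/-! ### Set functions: Kelly, Kocay, convolution and deconvolution -/

namespace VertexMatching

open Finset

variable {V W : Type u} {R : Type*} (Φ : VertexMatching V W)

/-- Two set functions are paired if they agree on sets that avoid a vertex `v`, when such sets are
transported along the bijection belonging to `v`. -/
def Paired (a : Finset V → R) (b : Finset W → R) : Prop :=
  ∀ v S, v ∉ S → a S = b (S.map (Φ.equiv v).toEmbedding)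

/-- The convolution of set functions. -/
def conv {U : Type*} [DecidableEq U] [CommRing R] (a b : Finset U → R) (S : Finset U) : R :=
  ∑ T ∈ S.powerset, a T * b (S \ T)

theorem Paired.conv [DecidableEq V] [DecidableEq W] [CommRing R] {Φ : VertexMatching V W}
    {a c : Finset V → R} {b d : Finset W → R}
    (h : Φ.Paired a b) (h' : Φ.Paired c d) : Φ.Paired (conv a c) (conv b d) := by
  intro v S hv
  unfold VertexMatching.conv
  refine sum_equiv (Φ.equiv v).finsetCongr (fun T => by simp) fun T hT => ?_
  have hT := mem_powerset.1 hT
  rw [h v T fun h => hv (hT h), h' v (S \ T) fun h => hv (sdiff_subset h), Finset.map_sdiff]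
  rfl

variable [Fintype V] [Fintype W]

/-- Two set functions agree if they are paired and have the same value at the whole set. -/
def Agree (a : Finset V → R) (b : Finset W → R) : Prop :=
  Φ.Paired a b ∧ a univ = b univ

variable {Φ}

theorem card_eq (Φ : VertexMatching V W) : Fintype.card V = Fintype.card W :=
  Fintype.card_of_bijective Φ.bijective

theorem Agree.comp_card (Φ : VertexMatching V W) (f : ℕ → R) :
    Φ.Agree (fun S => f S.card) (fun S => f S.card) :=
  ⟨fun v S _ => by simp, by simp [card_univ, Φ.card_eq]⟩

variable [DecidableEq V] [DecidableEq W] [CommRing R]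

/-- Kelly's lemma for set functions. -/
theorem Paired.sum_powersetCard [IsDomain R] [CharZero R] {a : Finset V → R} {b : Finset W → R}
    (h : Φ.Paired a b) {k : ℕ} (hk : k < Fintype.card V) :
    ∑ S ∈ powersetCard k univ, a S = ∑ S ∈ powersetCard k univ, b S := by
  -- A `k`-set is counted once for each vertex outside it. As `k` is less than the number of
  -- vertices, this multiplicity is nonzero and cancels.
  have key : ∀ (U : Type u) [Fintype U] [DecidableEq U] (c : Finset U → R),
      ∑ v : U, ∑ S ∈ powersetCard k (univ.erase v), c S
        = ((Fintype.card U - k : ℕ) : R) * ∑ S ∈ powersetCard k univ, c S := by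
    intro U _ _ c
    have h1 : ∀ v : U, ∑ S ∈ powersetCard k (univ.erase v), c S
        = ∑ S ∈ powersetCard k univ, if v ∉ S then c S else 0 := by
      intro v
      rw [← sum_filter]
      apply sum_congr _ fun _ _ => rfl
      ext S
      simp [mem_powersetCard, subset_erase, and_comm]
    rw [sum_congr rfl fun v _ => h1 v, sum_comm, mul_sum]
    refine sum_congr rfl fun S hS => ?_
    rw [← sum_filter, sum_const, nsmul_eq_mul]
    congr 2
    rw [← (mem_powersetCard.1 hS).2, ← card_compl]
    congr 1
    ext; simp
  have h2 := key V a
  have h3 := key W b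
  rw [← Φ.card_eq, ← Fintype.sum_bijective _ Φ.bijective
    (fun v => ∑ S ∈ powersetCard k (univ.erase v), a S) _ ?_, h2] at h3
  · exact mul_left_cancel₀ (by exact_mod_cast (Nat.sub_pos_of_lt hk).ne') h3
  · intro v
    have : (univ : Finset W).erase (Φ.equiv v v)
        = (univ.erase v).map (Φ.equiv v).toEmbedding := by simp [map_erase]
    rw [this, powersetCard_map, sum_map]
    refine sum_congr rfl fun S hS => ?_
    refine h v S fun hv => ?_
    simpa using (mem_powersetCard.1 hS).1 hv

theorem Paired.sum_erase_univ [IsDomain R] [CharZero R] {a : Finset V → R} {b : Finset W → R}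
    (h : Φ.Paired a b) : ∑ S ∈ univ.erase univ, a S = ∑ S ∈ univ.erase univ, b S := by
  have key : ∀ (U : Type u) [Fintype U] [DecidableEq U] (c : Finset U → R),
      ∑ S ∈ univ.erase univ, c S
        = ∑ k ∈ range (Fintype.card U), ∑ S ∈ powersetCard k univ, c S := by
    intro U _ _ c
    rw [← sum_fiberwise_of_maps_to (g := card) (t := range (Fintype.card U))]
    · refine sum_congr rfl fun k hk => sum_congr ?_ fun _ _ => rfl
      ext S
      simp only [mem_filter, mem_erase, mem_univ, mem_powersetCard, subset_univ, and_true, true_and,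
        and_iff_right_iff_imp]
      rintro rfl rfl
      simp at hk
    · intro S hS
      simpa [card_lt_iff_ne_univ] using hS
  rw [key, key, ← Φ.card_eq]
  exact sum_congr rfl fun k hk => h.sum_powersetCard (mem_range.1 hk)

theorem sum_powersetCard_mul_powersetCard_compl {U : Type*} [Fintype U] [DecidableEq U]
    {k l : ℕ} (hkl : k + l = Fintype.card U) (a b : Finset U → R) :
    ∑ S ∈ powersetCard k univ, ∑ T ∈ powersetCard l univ, (if S ∪ T = univ then a S * b T else 0)
      = ∑ S ∈ powersetCard k univ, a S * b Sᶜ := by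
  refine sum_congr rfl fun S hS => ?_
  rw [sum_eq_single Sᶜ]
  · simp
  · intro T hT hne
    rw [if_neg]
    intro hu
    apply hne
    refine (eq_of_subset_of_card_le ?_ ?_).symm
    · intro x hx
      have := hu ▸ mem_univ x
      simp only [mem_union, mem_compl] at this hx
      tauto
    · rw [(mem_powersetCard.1 hT).2, card_compl, (mem_powersetCard.1 hS).2]; omega
  · intro hS'
    refine absurd (mem_powersetCard.2 ⟨subset_univ _, ?_⟩) hS'
    rw [card_compl, (mem_powersetCard.1 hS).2]; omega

/-- Kocay's lemma for products of two set functions. -/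
theorem Paired.sum_mul_compl [IsDomain R] [CharZero R]
    {a c : Finset V → R} {b d : Finset W → R} (h : Φ.Paired a b) (h' : Φ.Paired c d)
    {k : ℕ} (h0 : 0 < k) (hk : k < Fintype.card V) :
    ∑ S ∈ powersetCard k univ, a S * c Sᶜ = ∑ S ∈ powersetCard k univ, b S * d Sᶜ := by
  set l := Fintype.card V - k with hl
  -- Pairs of sizes `k` and `l` sorted by their union `M`. At `M = univ` the sizes force
  -- complements; the terms with `M ≠ univ` form a paired function, so Kelly's lemma removes them.
  let g (U : Type u) [DecidableEq U] (a c : Finset U → R) (M : Finset U) : R :=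
    ∑ S ∈ powersetCard k M, ∑ T ∈ powersetCard l M, if S ∪ T = M then a S * c T else 0
  have key : ∀ (U : Type u) [Fintype U] [DecidableEq U] (a c : Finset U → R),
      k + l = Fintype.card U →
      (∑ S ∈ powersetCard k univ, a S) * (∑ S ∈ powersetCard l univ, c S)
        = ∑ S ∈ powersetCard k univ, a S * c Sᶜ + ∑ M ∈ univ.erase univ, g U a c M := by
    intro U _ _ a c hkl
    rw [← sum_powersetCard_mul_powersetCard_compl hkl,
      add_sum_erase univ (g U a c) (mem_univ univ)]
    have h1 : ∀ M : Finset U, g U a c M = ∑ S ∈ powersetCard k univ, ∑ T ∈ powersetCard l univ,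
        if S ∪ T = M then a S * c T else 0 := by
      intro M
      simp only [g]
      refine sum_subset_zero_on_sdiff (powersetCard_mono (subset_univ M)) ?_ ?_
      · intro S hS
        refine sum_eq_zero fun T _ => if_neg ?_
        rintro rfl
        simp [mem_powersetCard] at hS
      · intro S hS
        refine sum_subset_zero_on_sdiff (powersetCard_mono (subset_univ M)) ?_ fun _ _ => rfl
        intro T hT
        refine if_neg ?_
        rintro rfl
        simp [mem_powersetCard] at hT
    simp_rw [h1]
    rw [sum_comm, sum_mul_sum]
    refine sum_congr rfl fun S _ => ?_
    rw [sum_comm]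
    simp
  have hg : Φ.Paired (g V a c) (g W b d) := by
    intro v M hv
    simp only [g]
    rw [powersetCard_map, sum_map]
    refine sum_congr rfl fun S hS => ?_
    rw [powersetCard_map, sum_map]
    refine sum_congr rfl fun T hT => ?_
    simp only [RelEmbedding.coe_toEmbedding, mapEmbedding_apply, ← map_union,
      map_inj]
    rw [h v S fun hvS => hv ((mem_powersetCard.1 hS).1 hvS),
      h' v T fun hvT => hv ((mem_powersetCard.1 hT).1 hvT)]
  have e1 := key V a c (by omega)
  have e2 := key W b d (by rw [← Φ.card_eq]; omega)
  rw [h.sum_powersetCard hk, h'.sum_powersetCard (by omega), e2, hg.sum_erase_univ] at e1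
  exact (add_right_cancel e1).symm

/-- The part of the convolution at the whole set that does not involve the whole set. -/
theorem Paired.sum_Ioo [IsDomain R] [CharZero R]
    {a c : Finset V → R} {b d : Finset W → R} (h : Φ.Paired a b) (h' : Φ.Paired c d) :
    ∑ S ∈ Ioo ∅ univ, a S * c Sᶜ = ∑ S ∈ Ioo ∅ univ, b S * d Sᶜ := by
  have key : ∀ (U : Type u) [Fintype U] [DecidableEq U] (c : Finset U → R),
      ∑ S ∈ Ioo ∅ univ, c S
        = ∑ k ∈ Ioo 0 (Fintype.card U), ∑ S ∈ powersetCard k univ, c S := by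
    intro U _ _ c
    rw [← sum_fiberwise_of_maps_to (g := card) (t := Ioo 0 (Fintype.card U))]
    · refine sum_congr rfl fun k hk => sum_congr ?_ fun _ _ => rfl
      ext S
      simp only [mem_Ioo] at hk
      simp only [mem_filter, mem_Ioo, mem_powersetCard, subset_univ, true_and,
        and_iff_right_iff_imp]
      rintro rfl
      exact ⟨card_pos.1 hk.1 |>.empty_ssubset, ssubset_univ_iff.2 (card_lt_iff_ne_univ _ |>.1 hk.2)⟩
    · intro S hS
      have := mem_Ioo.1 hS
      exact mem_Ioo.2 ⟨card_pos.2 (empty_ssubset.1 this.1),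
        (card_lt_iff_ne_univ _).2 (ssubset_univ_iff.1 this.2)⟩
  rw [key, key, ← Φ.card_eq]
  exact sum_congr rfl fun k hk => h.sum_mul_compl h' (mem_Ioo.1 hk).1 (mem_Ioo.1 hk).2

/-- Nonemptiness keeps the extreme terms `∅` and `univ` distinct. -/
theorem conv_univ {U : Type*} [Fintype U] [DecidableEq U] [Nonempty U] (a b : Finset U → R) :
    conv a b univ = a univ * b ∅ + (a ∅ * b univ + ∑ S ∈ Ioo ∅ univ, a S * b Sᶜ) := by
  have h1 : (univ : Finset U).powerset = insert univ (insert ∅ (Ioo ∅ univ)) := by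
    ext S
    simp only [mem_powerset, subset_univ, mem_insert, mem_Ioo, true_iff]
    by_cases h : S = ∅
    · tauto
    · by_cases h' : S = univ
      · tauto
      · exact Or.inr (Or.inr ⟨bot_lt_iff_ne_bot.2 h, lt_top_iff_ne_top.2 h'⟩)
  unfold conv
  rw [h1, sum_insert, sum_insert]
  · simp [compl_eq_univ_sdiff]
  · simp
  · simp

/-- Kocay's lemma handles the middle terms at the whole set; the two extreme terms need the values
at `univ`, which `Agree` supplies. -/
theorem Agree.conv [IsDomain R] [CharZero R] [Nonempty V]
    {a c : Finset V → R} {b d : Finset W → R}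
    (h : Φ.Agree a b) (h' : Φ.Agree c d) : Φ.Agree (conv a c) (conv b d) := by
  refine ⟨h.1.conv h'.1, ?_⟩
  obtain ⟨v⟩ := ‹Nonempty V›
  have : Nonempty W := ⟨Φ.equiv v v⟩
  rw [conv_univ, conv_univ, h.1.sum_Ioo h'.1, h.2, h'.2, h.1 v ∅ (by simp), h'.1 v ∅ (by simp)]
  simp

/-- Deconvolution by a set function with value `1` at the empty set. -/
theorem Agree.of_conv [IsDomain R] [CharZero R] [Nonempty V]
    {a c : Finset V → R} {b d : Finset W → R}
    (h : Φ.Agree (VertexMatching.conv a c) (VertexMatching.conv b d)) (h' : Φ.Agree c d)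
    (hc : c ∅ = 1) : Φ.Agree a b := by
  have hd : d ∅ = 1 := by
    obtain ⟨v⟩ := ‹Nonempty V›
    rw [← hc, h'.1 v ∅ (by simp)]; simp
  have h1 : Φ.Paired a b := by
    intro v S
    -- The term of the whole set `S` has coefficient `c ∅ = 1`; all other terms involve `a` at
    -- proper subsets only.
    induction S using Finset.strongInduction with
    | H S ih =>
      intro hv
      have e := h.1 v S hv
      unfold VertexMatching.conv at e
      rw [← add_sum_erase _ _ (mem_powerset_self S), ← add_sum_erase _ _ (mem_powerset_self (map _ S)),
        sdiff_self, sdiff_self, bot_eq_empty, bot_eq_empty, hc, hd, mul_one, mul_one] at e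
      refine add_right_cancel (e.trans ?_)
      congr 1
      symm
      refine sum_equiv (Φ.equiv v).finsetCongr (fun T => ?_) fun T hT => ?_
      · simp
      · obtain ⟨hne, hT⟩ := mem_erase.1 hT
        have hT := mem_powerset.1 hT
        rw [ih T (hT.ssubset_of_ne hne) fun h => hv (hT h),
          h'.1 v (S \ T) fun h => hv (sdiff_subset h), Finset.map_sdiff]
        rfl
  refine ⟨h1, ?_⟩
  have e := h.2
  obtain ⟨v⟩ := ‹Nonempty V›
  have : Nonempty W := ⟨Φ.equiv v v⟩
  rw [conv_univ, conv_univ, h1.sum_Ioo h'.1, h'.2, h1 v ∅ (by simp), hc, hd] at e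
  simpa using e

end VertexMatching

namespace VertexMatching

open Finset

/-! ### Reconstructing the multiset of edge weights -/

section EdgeWeights

variable {V W : Type u} {R : Type*} {Φ : VertexMatching V W}

/-- Two edge weights agree on edges that avoid a vertex `v`, when such edges are transported along
the bijection belonging to `v`. -/
def Compatible (Φ : VertexMatching V W) (t : Sym2 V → R) (t' : Sym2 W → R) : Prop :=
  ∀ v e, v ∉ e → t e = t' (e.map (Φ.equiv v))

theorem Compatible.comp {R' : Type*} {t : Sym2 V → R} {t' : Sym2 W → R} (h : Φ.Compatible t t')
    (f : R → R') : Φ.Compatible (f ∘ t) (f ∘ t') :=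
  fun v e hv => congrArg f (h v e hv)

theorem Compatible.sum_eq [Fintype V] [Fintype W] [DecidableEq V] [DecidableEq W]
    [CommRing R] [IsDomain R] [CharZero R]
    {t : Sym2 V → R} {t' : Sym2 W → R} (h : Φ.Compatible t t') (hV : 3 ≤ Fintype.card V) :
    ∑ e, t e = ∑ e, t' e := by
  -- Weights are grouped by the set of endpoints. It has at most two elements, so with three
  -- vertices it is never the whole set and Kelly's lemma sees every pair.
  let a (U : Type u) [DecidableEq U] (s : Sym2 U → R) (S : Finset U) : R :=
    ∑ e ∈ S.sym2, if e.toFinset = S then s e else 0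
  have key : ∀ (U : Type u) [Fintype U] [DecidableEq U] (s : Sym2 U → R), 3 ≤ Fintype.card U →
      ∑ e, s e = ∑ S ∈ univ.erase univ, a U s S := by
    intro U _ _ s hU
    rw [← sum_fiberwise_of_maps_to (g := Sym2.toFinset) (t := univ.erase univ)]
    · refine sum_congr rfl fun S _ => ?_
      rw [sum_filter]
      symm
      refine sum_subset (subset_univ _) fun e _ he => if_neg ?_
      rintro rfl
      exact he (mem_sym2_iff.2 fun v hv => by simpa using hv)
    · intro e _
      simp only [mem_erase, mem_univ, and_true]
      intro he
      have h2 : e.toFinset.card ≤ 2 := by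
        have := e.card_toFinset
        split_ifs at this <;> omega
      rw [he, card_univ] at h2
      omega
  have ha : Φ.Paired (a V t) (a W t') := by
    intro v S hv
    simp only [a]
    rw [sym2_map, sum_map]
    refine sum_congr rfl fun e he => ?_
    have hve : v ∉ e := fun hve => hv (mem_sym2_iff.1 he v hve)
    have : (Sym2.map (Φ.equiv v) e).toFinset = e.toFinset.map (Φ.equiv v).toEmbedding := by
      ext x
      simp only [Sym2.mem_toFinset, Sym2.mem_map, mem_map_equiv]
      exact ⟨by rintro ⟨y, hy, rfl⟩; simpa using hy, fun hx => ⟨_, hx, by simp⟩⟩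
    simp [this, ← h v e hve]
  rw [key V t hV, key W t' (Φ.card_eq ▸ hV), ha.sum_erase_univ]

theorem Compatible.map_univ_eq [Fintype V] [Fintype W] {t : Sym2 V → R} {t' : Sym2 W → R}
    (h : Φ.Compatible t t') (hV : 3 ≤ Fintype.card V) :
    (univ : Finset (Sym2 V)).val.map t = (univ : Finset (Sym2 W)).val.map t' := by
  classical
  ext r
  -- Summing the indicator of the value `r` gives the multiplicity of `r`.
  have := (h.comp fun s => if s = r then (1 : ℤ) else 0).sum_eq hV
  simp only [Function.comp_apply, sum_boole, Nat.cast_inj] at this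
  simpa [Multiset.count_map, Finset.card_def, eq_comm] using this

end EdgeWeights

section Weight

variable {V W : Type u} {R : Type*} [CommRing R]
  {Φ : VertexMatching V W}

/-- The total weight of all edge sets within the vertex set `S`. -/
def weight (t : Sym2 V → R) (S : Finset V) : R :=
  ∏ e ∈ S.sym2, (1 + t e)

theorem weight_agree [Fintype V] [Fintype W] {t : Sym2 V → R} {t' : Sym2 W → R}
    (h : Φ.Compatible t t') (hV : 3 ≤ Fintype.card V) : Φ.Agree (weight t) (weight t') := by
  constructor
  · intro v S hv
    unfold weight
    rw [sym2_map, prod_map]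
    refine prod_congr rfl fun e he => ?_
    rw [h v e fun hve => hv (mem_sym2_iff.1 he v hve)]
    rfl
  · unfold weight
    have := congrArg Multiset.prod (congrArg (Multiset.map (1 + ·)) (h.map_univ_eq hV))
    rw [Multiset.map_map, Multiset.map_map] at this
    rw [sym2_univ, sym2_univ]
    exact this

end Weight

/-! ### Vertex colorings and convolution powers -/

section Colorings

variable {V : Type u} [Fintype V] [DecidableEq V]

/-- The functions on `S` with values in `{1, …, q}`, extended by `0`. -/
def colorings (q : ℕ) (S : Finset V) : Finset (V → ℕ) :=
  Fintype.piFinset fun v => if v ∈ S then Icc 1 q else {0}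

theorem mem_colorings {q : ℕ} {S : Finset V} {f : V → ℕ} :
    f ∈ colorings q S ↔ ∀ v, (v ∈ S → 1 ≤ f v ∧ f v ≤ q) ∧ (v ∉ S → f v = 0) := by
  simp only [colorings, Fintype.mem_piFinset]
  refine forall_congr' fun v => ?_
  by_cases h : v ∈ S <;> simp [h]

/-- Splitting off the color class of `q + 1` leaves a coloring of the remaining vertices by `q`
colors. The value `0` marks vertices outside the set. -/
theorem sum_colorings_succ {R : Type*} [CommRing R] (F : Finset V → R) (q : ℕ) (S : Finset V) :
    ∑ f ∈ colorings (q + 1) S, ∏ i ∈ Icc 1 (q + 1), F {v | f v = i}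
      = conv F (fun T => ∑ f ∈ colorings q T, ∏ i ∈ Icc 1 q, F {v | f v = i}) S := by
  unfold conv
  rw [← sum_fiberwise_of_maps_to (g := fun f => ({v | f v = q + 1} : Finset V)) (t := S.powerset)]
  · refine sum_congr rfl fun T hT => ?_
    have hT := mem_powerset.1 hT
    rw [mul_sum]
    refine sum_bij' (fun f _ v => if v ∈ T then 0 else f v)
      (fun f _ v => if v ∈ T then q + 1 else f v) ?_ ?_ ?_ ?_ ?_
    · intro f hf
      obtain ⟨hf, hfT⟩ := mem_filter.1 hf
      rw [mem_colorings] at hf ⊢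
      intro v
      have := hf v
      simp only [← hfT, mem_sdiff, mem_filter, mem_univ, true_and]
      grind
    · intro f hf
      rw [mem_filter, mem_colorings]
      rw [mem_colorings] at hf
      constructor
      · intro v
        have := hf v
        have := @hT v
        grind
      · ext v
        have := hf v
        have := @hT v
        simp only [mem_filter, mem_univ, true_and, mem_sdiff] at *
        grind
    · intro f hf
      obtain ⟨hf, hfT⟩ := mem_filter.1 hf
      ext v
      simp only [← hfT, mem_filter, mem_univ, true_and]
      grind
    · intro f hf
      ext v
      have := mem_colorings.1 hf v
      grind
    · intro f hf
      obtain ⟨hf, hfT⟩ := mem_filter.1 hf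
      rw [prod_Icc_succ_top (by omega), mul_comm, hfT]
      congr 1
      refine prod_congr rfl fun i hi => congrArg F ?_
      ext v
      have hi := mem_Icc.1 hi
      simp only [← hfT, mem_filter, mem_univ, true_and]
      grind
  · intro f hf
    rw [mem_powerset]
    intro v hv
    have := mem_colorings.1 hf v
    simp only [mem_filter, mem_univ, true_and] at hv
    grind

end Colorings

end VertexMatching

namespace VertexMatching

open Finset SimpleGraph

/-! ### Counting components by colorings -/

section Components

variable {V : Type u}

/-- The number of connected components of the graph with vertex set `S` and edge set `A`. -/
noncomputable def comps (S : Finset V) (A : Finset (Sym2 V)) : ℕ :=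
  Nat.card ((fromEdgeSet (A : Set (Sym2 V))).induce (S : Set V)).ConnectedComponent

variable [Fintype V] [DecidableEq V]

/-- The functions on `S` with values in `{1, …, q}` that are constant along the edges in `A`. -/
def constColorings (q : ℕ) (S : Finset V) (A : Finset (Sym2 V)) : Finset (V → ℕ) :=
  {f ∈ colorings q S | ∀ u v, s(u, v) ∈ A → f u = f v}

theorem mem_constColorings {q : ℕ} {S : Finset V} {A : Finset (Sym2 V)} {f : V → ℕ} :
    f ∈ constColorings q S A ↔
      (∀ v, (v ∈ S → 1 ≤ f v ∧ f v ≤ q) ∧ (v ∉ S → f v = 0)) ∧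
        ∀ u v, s(u, v) ∈ A → f u = f v := by
  rw [constColorings, mem_filter, mem_colorings]

theorem card_constColorings (q : ℕ) {S : Finset V} {A : Finset (Sym2 V)} (hA : A ⊆ S.sym2) :
    (constColorings q S A).card = q ^ comps S A := by
  classical
  set G := (fromEdgeSet (A : Set (Sym2 V))).induce (S : Set V) with hG
  have hA' : ∀ {x y}, s(x, y) ∈ A → x ∈ S ∧ y ∈ S := fun hx => by simpa using hA hx
  have : Fintype G.ConnectedComponent := Fintype.ofFinite _
  have hcard : q ^ comps S A = (univ : Finset (G.ConnectedComponent → Fin q)).card := by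
    simp [comps, Nat.card_eq_fintype_card, hG]
  rw [hcard]
  symm
  -- Colors are shifted by one, because `0` is reserved for vertices outside `S`.
  refine card_bij (fun g _ v => if h : v ∈ S then (g (G.connectedComponentMk ⟨v, h⟩) : ℕ) + 1 else 0)
    ?_ ?_ ?_
  · intro g _
    rw [mem_constColorings]
    refine ⟨fun v => ⟨fun hv => ?_, fun hv => dif_neg hv⟩, fun u v huv => ?_⟩
    · rw [dif_pos hv]
      have := (g (G.connectedComponentMk ⟨v, hv⟩)).2
      omega
    · obtain ⟨hu, hv⟩ := hA' huv
      rw [dif_pos hu, dif_pos hv]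
      by_cases h : u = v
      · subst h; rfl
      · have : G.connectedComponentMk ⟨u, hu⟩ = G.connectedComponentMk ⟨v, hv⟩ := by
          apply ConnectedComponent.sound
          apply Adj.reachable
          simp [hG, huv, h]
        rw [this]
  · intro g _ g' _ h
    ext c
    obtain ⟨⟨v, hv⟩, rfl⟩ := c.exists_rep
    have := congrFun h v
    have hv' : v ∈ S := hv
    simpa [hv', connectedComponentMk] using this
  · intro f hf
    rw [mem_constColorings] at hf
    obtain ⟨hf, hf'⟩ := hf
    have key : ∀ u v : (S : Set V), G.Reachable u v → f u = f v := by
      rintro u v ⟨p⟩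
      induction p with
      | nil => rfl
      | cons h _ ih =>
        rw [← ih]
        simp only [hG, comap_adj, fromEdgeSet_adj] at h
        exact hf' _ _ h.1
    refine ⟨fun c => ConnectedComponent.lift (G := G) (fun v => ⟨f v - 1, ?_⟩) ?_ c, mem_univ _, ?_⟩
    · have := (hf v).1 v.2
      omega
    · intro u v p _
      simp [key u v ⟨p⟩]
    · ext v
      by_cases hv : v ∈ S
      · have := (hf v).1 hv
        simp only [hv, dif_pos, ConnectedComponent.lift_mk]
        omega
      · simp [hv, (hf v).2 hv]

/-- Restriction to `S` and `T` makes the number of two-valued functions constant along edges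
multiplicative; exponents of `2` are then compared. -/
theorem comps_union {S T : Finset V} (h : Disjoint S T) {A B : Finset (Sym2 V)}
    (hA : A ⊆ S.sym2) (hB : B ⊆ T.sym2) : comps (S ∪ T) (A ∪ B) = comps S A + comps T B := by
  have hST : ∀ {x}, x ∈ S → x ∉ T := fun hx hx' => disjoint_left.1 h hx hx'
  have hA' : ∀ {x y}, s(x, y) ∈ A → x ∈ S ∧ y ∈ S := fun hx => by simpa using hA hx
  have hB' : ∀ {x y}, s(x, y) ∈ B → x ∈ T ∧ y ∈ T := fun hx => by simpa using hB hx
  apply Nat.pow_right_injective le_rfl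
  dsimp only
  rw [pow_add, ← card_constColorings 2 hA, ← card_constColorings 2 hB, ← card_constColorings 2
    (union_subset (hA.trans (sym2_mono subset_union_left)) (hB.trans (sym2_mono subset_union_right))),
    ← card_product]
  refine card_bij' (fun f _ => (fun v => if v ∈ S then f v else 0, fun v => if v ∈ T then f v else 0))
    (fun f _ v => if v ∈ S then f.1 v else f.2 v) ?_ ?_ ?_ ?_
  · intro f hf
    simp only [mem_product, mem_constColorings, mem_union] at hf ⊢
    grind
  · intro f hf
    simp only [mem_product, mem_constColorings, mem_union] at hf ⊢
    grind
  · intro f hf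
    ext v
    simp only [mem_constColorings, mem_union] at hf
    grind
  · intro f hf
    simp only [mem_product, mem_constColorings] at hf
    ext v <;> grind

theorem comps_empty_right (S : Finset V) : comps S ∅ = S.card := by
  apply Nat.pow_right_injective le_rfl
  dsimp only
  rw [← card_constColorings 2 (empty_subset _), constColorings]
  simp [colorings, Fintype.card_piFinset, apply_ite card]

end Components

/-! ### The multivariate Tutte polynomial and its covering part -/

section Potts

variable {V W : Type u} [Fintype V] [DecidableEq V] [Fintype W] [DecidableEq W]
  {R : Type*} [CommRing R] {Φ : VertexMatching V W}

/-- The multivariate Tutte polynomial of the subgraph induced by `S`, with edge weights `t`. -/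
noncomputable def potts (t : Sym2 V → R) (x : R) (S : Finset V) : R :=
  ∑ A ∈ S.sym2.powerset, x ^ comps S A * ∏ e ∈ A, t e

/-- Expanding the product selects the sets of pairs lying inside color classes, that is, those along
which `f` is constant. -/
theorem prod_weight_eq_sum (t : Sym2 V → R) {q : ℕ} {S : Finset V} {f : V → ℕ}
    (hf : f ∈ colorings q S) :
    ∏ i ∈ Icc 1 q, weight t {v | f v = i}
      = ∑ A ∈ S.sym2.powerset, if f ∈ constColorings q S A then ∏ e ∈ A, t e else 0 := by
  have hf' := mem_colorings.1 hf
  unfold weight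
  rw [← prod_biUnion, prod_one_add, ← sum_filter]
  · refine sum_congr ?_ fun _ _ => rfl
    ext A
    simp only [mem_powerset, mem_filter, constColorings, hf, true_and]
    constructor
    · intro h
      constructor
      · intro e he
        obtain ⟨i, hi, he⟩ := mem_biUnion.1 (h he)
        rw [mem_sym2_iff] at he ⊢
        intro v hv
        have := (mem_filter.1 (he v hv)).2
        by_contra hvS
        have := (hf' v).2 hvS
        have := (mem_Icc.1 hi).1
        omega
      · intro u v huv
        obtain ⟨i, hi, he⟩ := mem_biUnion.1 (h huv)
        simp at he
        rw [he.1, he.2]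
    · rintro ⟨h, h'⟩ e he
      induction e with
      | h u v =>
        have huv : u ∈ S ∧ v ∈ S := by simpa using h he
        refine mem_biUnion.2 ⟨f u, mem_Icc.2 ((hf' u).1 huv.1), ?_⟩
        simp [h' u v he]
  · intro i _ j _ hij
    refine disjoint_left.2 fun e he he' => hij ?_
    induction e with
    | h u v =>
      simp at he he'
      rw [← he.1, he'.1]

theorem potts_natCast (t : Sym2 V → R) (q : ℕ) (S : Finset V) :
    potts t (q : R) S = ∑ f ∈ colorings q S, ∏ i ∈ Icc 1 q, weight t {v | f v = i} := by
  rw [sum_congr rfl fun f hf => prod_weight_eq_sum t hf, sum_comm]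
  refine sum_congr rfl fun A hA => ?_
  rw [← sum_filter, sum_const, nsmul_eq_mul, filter_mem_eq_inter,
    inter_eq_right.2 (show constColorings q S A ⊆ _ from filter_subset _ _), card_constColorings q (mem_powerset.1 hA), Nat.cast_pow]

theorem potts_natCast_agree [IsDomain R] [CharZero R] {t : Sym2 V → R} {t' : Sym2 W → R}
    (h : Φ.Compatible t t') (hV : 3 ≤ Fintype.card V) (q : ℕ) :
    Φ.Agree (potts t (q : R)) (potts t' (q : R)) := by
  have : Nonempty V := Fintype.card_pos_iff.1 (by omega)
  rw [funext (potts_natCast t q), funext (potts_natCast t' q)]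
  induction q with
  | zero =>
    -- Without colors only the empty set has a coloring, so the sum depends on the cardinality
    -- alone.
    have key : ∀ (U : Type u) [Fintype U] [DecidableEq U] (S : Finset U),
        (colorings 0 S).card = 0 ^ S.card := by
      intro U _ _ S
      simp [colorings, Fintype.card_piFinset, apply_ite card]
    simp only [Icc_eq_empty_of_lt Nat.zero_lt_one, prod_empty, sum_const, key]
    exact Agree.comp_card Φ fun n => 0 ^ n • (1 : R)
  | succ q ih =>
    rw [funext (sum_colorings_succ (weight t) q), funext (sum_colorings_succ (weight t') q)]
    exact (weight_agree h hV).conv ih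

/-- Two polynomials over a domain of characteristic zero that agree at all natural numbers are
equal. -/
theorem sum_pow_mul_eq {ι κ : Type*} [IsDomain R] [CharZero R] (s : Finset ι) (s' : Finset κ)
    (a : ι → ℕ) (b : κ → ℕ) (c : ι → R) (d : κ → R)
    (h : ∀ q : ℕ, ∑ i ∈ s, (q : R) ^ a i * c i = ∑ j ∈ s', (q : R) ^ b j * d j) (x : R) :
    ∑ i ∈ s, x ^ a i * c i = ∑ j ∈ s', x ^ b j * d j := by
  have : ∑ i ∈ s, (Polynomial.X : Polynomial R) ^ a i * Polynomial.C (c i)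
      = ∑ j ∈ s', Polynomial.X ^ b j * Polynomial.C (d j) := by
    refine Polynomial.eq_of_infinite_eval_eq _ _ ((Set.infinite_range_of_injective
      (Nat.cast_injective (R := R))).mono ?_)
    rintro _ ⟨q, rfl⟩
    simp only [Set.mem_ofPred_eq, Polynomial.eval_finsetSum, Polynomial.eval_mul,
      Polynomial.eval_pow, Polynomial.eval_X, Polynomial.eval_C]
    exact h q
  simpa only [Polynomial.eval_finsetSum, Polynomial.eval_mul, Polynomial.eval_pow,
    Polynomial.eval_X, Polynomial.eval_C] using congrArg (Polynomial.eval x) this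

theorem potts_agree [IsDomain R] [CharZero R] {t : Sym2 V → R} {t' : Sym2 W → R}
    (h : Φ.Compatible t t') (hV : 3 ≤ Fintype.card V) (x : R) :
    Φ.Agree (potts t x) (potts t' x) :=
  ⟨fun v S hv => sum_pow_mul_eq _ _ _ _ _ _
    (fun q => (potts_natCast_agree h hV q).1 v S hv) x,
  sum_pow_mul_eq _ _ _ _ _ _ (fun q => (potts_natCast_agree h hV q).2) x⟩

/-- The set of vertices covered by `A`. -/
def covered (A : Finset (Sym2 V)) : Finset V :=
  {v | ∃ e ∈ A, v ∈ e}

theorem covered_subset_iff {A : Finset (Sym2 V)} {S : Finset V} :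
    covered A ⊆ S ↔ A ⊆ S.sym2 := by
  simp only [covered, subset_iff, mem_filter, mem_univ, true_and, mem_sym2_iff]
  grind

theorem subset_sym2_covered (A : Finset (Sym2 V)) : A ⊆ (covered A).sym2 :=
  covered_subset_iff.1 Subset.rfl

/-- The part of the multivariate Tutte polynomial of the subgraph induced by `S` that comes from the
edge sets covering `S`. -/
noncomputable def coverPotts (t : Sym2 V → R) (y : R) (S : Finset V) : R :=
  ∑ A ∈ S.sym2.powerset with covered A = S, y ^ comps S A * ∏ e ∈ A, t e

/-- Sort edge sets by the vertices they cover; each uncovered vertex is a component of its own and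
contributes a factor `y`. -/
theorem conv_coverPotts (t : Sym2 V → R) (y : R) (S : Finset V) :
    conv (coverPotts t y) (fun T => y ^ T.card) S = potts t y S := by
  unfold conv coverPotts potts
  rw [← sum_fiberwise_of_maps_to (g := covered) (t := S.powerset)]
  · refine sum_congr rfl fun T hT => ?_
    have hT := mem_powerset.1 hT
    rw [sum_mul]
    refine sum_congr ?_ fun A hA => ?_
    · ext A
      simp only [mem_filter, mem_powerset, and_congr_left_iff]
      rintro rfl
      exact ⟨fun _ => covered_subset_iff.1 hT, fun _ => subset_sym2_covered A⟩
    · obtain ⟨-, rfl⟩ := mem_filter.1 hA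
      have := comps_union (disjoint_sdiff (s := covered A) (t := S)) (subset_sym2_covered A)
        (empty_subset _)
      rw [union_sdiff_of_subset hT, union_empty, comps_empty_right] at this
      rw [this, pow_add]
      ring
  · intro A hA
    exact mem_powerset.2 (covered_subset_iff.2 (mem_powerset.1 hA))

theorem coverPotts_agree [IsDomain R] [CharZero R] {t : Sym2 V → R} {t' : Sym2 W → R}
    (h : Φ.Compatible t t') (hV : 3 ≤ Fintype.card V) (y : R) :
    Φ.Agree (coverPotts t y) (coverPotts t' y) := by
  have : Nonempty V := Fintype.card_pos_iff.1 (by omega)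
  refine Agree.of_conv (c := fun T => y ^ T.card) (d := fun T => y ^ T.card) ?_
    (Agree.comp_card Φ fun n => y ^ n) (by simp)
  rw [funext (conv_coverPotts t y), funext (conv_coverPotts t' y)]
  exact potts_agree h hV y

end Potts

end VertexMatching

/-! ### Disjointly covering pairs and matchings -/

namespace VertexMatching

open Finset

variable {V : Type u} [Fintype V] [DecidableEq V] {R : Type*} [CommRing R]

theorem mem_covered {A : Finset (Sym2 V)} {v : V} : v ∈ covered A ↔ ∃ e ∈ A, v ∈ e := by
  simp [covered]

theorem disjoint_of_disjoint_covered {A B : Finset (Sym2 V)}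
    (h : Disjoint (covered A) (covered B)) : Disjoint A B := by
  refine disjoint_left.2 fun e hA hB => ?_
  induction e with
  | h u v =>
    exact disjoint_left.1 h (mem_filter.2 ⟨mem_univ u, _, hA, Sym2.mem_mk_left u v⟩)
      (mem_filter.2 ⟨mem_univ u, _, hB, Sym2.mem_mk_left u v⟩)

theorem sum_coverPotts_mul (t : Sym2 V → R) (y : R) (F : Finset V → R) :
    conv (coverPotts t y) F univ
      = ∑ B, y ^ comps (covered B) B * (∏ e ∈ B, t e) * F (covered B)ᶜ := by
  unfold conv coverPotts
  rw [← sum_fiberwise_of_maps_to (s := univ) (g := covered) (t := univ.powerset) (by simp)]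
  refine sum_congr rfl fun T _ => ?_
  rw [sum_mul]
  refine sum_congr ?_ fun B hB => ?_
  · ext B
    simp only [mem_filter, mem_powerset, mem_univ, true_and, and_iff_right_iff_imp]
    rintro rfl
    exact subset_sym2_covered B
  · obtain ⟨-, rfl⟩ := mem_filter.1 hB
    rw [compl_eq_univ_sdiff]

/-- For fixed `B`, the sets `A` range over the pairs inside the complement of its cover. Components
of `B` carry both `x` and `z`, hence the argument `x * z`. -/
theorem sum_disjoint_eq_conv (t : Sym2 V → R) (x z : R) :
    ∑ A, ∑ B, (if Disjoint (covered A) (covered B) then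
        x ^ comps univ (A ∪ B) * (∏ e ∈ A ∪ B, t e) * z ^ comps (covered B) B else 0)
      = conv (coverPotts t (x * z)) (potts t x) univ := by
  rw [sum_coverPotts_mul, sum_comm]
  refine sum_congr rfl fun B _ => ?_
  rw [← sum_filter, potts, mul_sum]
  refine sum_congr ?_ fun A hA => ?_
  · ext A
    simp only [mem_filter, mem_univ, true_and, mem_powerset]
    rw [← covered_subset_iff, subset_compl_iff_disjoint_right]
  · have hA := subset_compl_iff_disjoint_right.1 (covered_subset_iff.2 (mem_powerset.1 hA))
    have hc := comps_union (disjoint_compl_left (a := covered B))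
      (covered_subset_iff.1 (subset_compl_iff_disjoint_right.2 hA)) (subset_sym2_covered B)
    rw [union_comm, union_compl] at hc
    rw [hc, prod_union (disjoint_of_disjoint_covered hA)]
    ring

/-- Double counting: the degrees of the covered vertices add up to `2 * A.card` and each is at least
one. -/
theorem two_mul_card_eq_card_covered_iff {A : Finset (Sym2 V)} (hA : ∀ e ∈ A, ¬ e.IsDiag) :
    2 * A.card = (covered A).card ↔
      ∀ e ∈ A, ∀ f ∈ A, ∀ v, v ∈ e → v ∈ f → e = f := by
  have h1 : ∑ v ∈ covered A, (A.filter (v ∈ ·)).card = 2 * A.card := by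
    simp_rw [card_filter]
    rw [sum_comm, mul_comm, ← smul_eq_mul, ← sum_const]
    refine sum_congr rfl fun e he => ?_
    rw [← card_filter, ← Sym2.card_toFinset_of_not_isDiag e (hA e he)]
    congr 1
    ext v
    simp only [covered, mem_filter, mem_univ, true_and, Sym2.mem_toFinset, and_iff_right_iff_imp]
    exact fun hv => ⟨e, he, hv⟩
  have h2 : ∀ v ∈ covered A, 1 ≤ (A.filter (v ∈ ·)).card := by
    intro v hv
    obtain ⟨e, he, hv⟩ := (mem_filter.1 hv).2
    exact card_pos.2 ⟨e, mem_filter.2 ⟨he, hv⟩⟩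
  rw [← h1, card_eq_sum_ones, eq_comm, sum_eq_sum_iff_of_le h2]
  constructor
  · intro h e he f hf v hve hvf
    have := (h v (mem_filter.2 ⟨mem_univ v, e, he, hve⟩)).symm
    exact card_le_one.1 this.le e (mem_filter.2 ⟨he, hve⟩) f (mem_filter.2 ⟨hf, hvf⟩)
  · intro h v hv
    refine le_antisymm (h2 v hv) (card_le_one.2 fun e he f hf => ?_)
    exact h e (mem_filter.1 he).1 f (mem_filter.1 hf).1 v (mem_filter.1 he).2 (mem_filter.1 hf).2

end VertexMatching

/-! ### From colored graphs to weights on pairs -/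

namespace ColoredGraph

open Finset VertexMatching MvPolynomial

variable {V W : Type u} {Λ : ℕ}

open Classical in
/-- The colour of an unordered pair of vertices that is an edge. -/
noncomputable def colorOf (G : ColoredGraph V Λ) (e : Sym2 V) : Option (Fin Λ) :=
  if h : e ∈ G.graph.edgeSet then some (G.color ⟨e, h⟩) else none

/-- The weight `τ_{c(e)}` of an unordered pair `e` of vertices, `0` if `e` is not an edge. -/
noncomputable def edgeWeight {R : Type*} [Zero R] (G : ColoredGraph V Λ) (τ : Fin Λ → R) :
    Sym2 V → R :=
  (fun o => o.elim 0 τ) ∘ G.colorOf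

theorem edgeWeight_coe {R : Type*} [Zero R] (G : ColoredGraph V Λ) (τ : Fin Λ → R)
    (e : G.graph.edgeSet) : G.edgeWeight τ e = τ (G.color e) := by
  simp [edgeWeight, colorOf]

theorem edgeWeight_of_notMem {R : Type*} [Zero R] (G : ColoredGraph V Λ) (τ : Fin Λ → R)
    {e : Sym2 V} (he : e ∉ G.graph.edgeSet) : G.edgeWeight τ e = 0 := by
  simp [edgeWeight, colorOf, he]

theorem IsReconstruction.exists_vertexMatching {G : ColoredGraph V Λ} {H : ColoredGraph W Λ}
    (h : IsReconstruction G H) : ∃ Φ : VertexMatching V W, Φ.Compatible G.colorOf H.colorOf := by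
  classical
  obtain ⟨σ, hσ⟩ := h
  choose φ hφ using hσ
  have hu : ∀ (U : Type u) (x : U), Nonempty (Unique {w // ¬ w ≠ x}) := fun U x =>
    ⟨⟨⟨⟨x, by simp⟩⟩, fun y => Subtype.ext (not_not.1 y.2)⟩⟩
  have := fun v => (hu V v).some
  have := fun v => (hu W v).some
  -- The isomorphism of cards, extended by `v ↦ σ v`.
  let ψ : V → V ≃ W := fun v =>
    (Equiv.sumCompl (· ≠ v)).symm.trans (((φ v).toEquiv.sumCongr
      (Equiv.ofUnique {w // ¬ w ≠ v} {w // ¬ w ≠ σ v})).trans (Equiv.sumCompl (· ≠ σ v)))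
  have hψ : ∀ v w (hw : w ≠ v), ψ v w = φ v ⟨w, hw⟩ := by
    intro v w hw
    simp [ψ, hw]
  have hψ' : ∀ v, ψ v v = σ v := by
    intro v
    have h1 : (Equiv.sumCompl (· ≠ v)).symm v = Sum.inr ⟨v, by simp⟩ :=
      Equiv.sumCompl_symm_apply_of_neg (by simp)
    simp only [ψ, Equiv.trans_apply, h1, Equiv.sumCongr_apply, Sum.map_inr, Equiv.sumCompl_apply_inr]
    exact not_not.1 ((Equiv.ofUnique {w // ¬ w ≠ v} {w // ¬ w ≠ σ v}) ⟨v, by simp⟩).2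
  refine ⟨⟨ψ, ?_⟩, ?_⟩
  · simp only [hψ']
    exact σ.bijective
  · intro v e hv
    induction e with
    | h a b =>
      have ha : a ≠ v := by rintro rfl; simp at hv
      have hb : b ≠ v := by rintro rfl; simp at hv
      simp only [Sym2.map_mk, hψ v a ha, hψ v b hb]
      have key : G.graph.Adj a b ↔ H.graph.Adj (φ v ⟨a, ha⟩) (φ v ⟨b, hb⟩) :=
        ((φ v).map_rel_iff (a := ⟨a, ha⟩) (b := ⟨b, hb⟩)).symm
      unfold colorOf
      by_cases hab : G.graph.Adj a b
      · rw [dif_pos (show s(a, b) ∈ G.graph.edgeSet from hab),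
          dif_pos (show s(_, _) ∈ H.graph.edgeSet from key.1 hab)]
        exact congrArg some (hφ v ⟨s(⟨a, ha⟩, ⟨b, hb⟩), hab⟩).symm
      · rw [dif_neg (show s(a, b) ∉ G.graph.edgeSet from hab),
          dif_neg (show s(_, _) ∉ H.graph.edgeSet from fun h => hab (key.2 h))]

variable (G : ColoredGraph V Λ)

/-- A set of edges of `G` as a set of unordered pairs of vertices. -/
def edges (A : Finset G.graph.edgeSet) : Finset (Sym2 V) :=
  A.map (Function.Embedding.subtype _)

theorem spanning_eq (A : Finset G.graph.edgeSet) :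
    G.spanning A = SimpleGraph.fromEdgeSet (G.edges A : Set (Sym2 V)) := by
  unfold spanning edges
  congr 1
  ext e
  simp

theorem prod_edges {R : Type*} [CommRing R] (τ : Fin Λ → R) (A : Finset G.graph.edgeSet) :
    ∏ e ∈ G.edges A, G.edgeWeight τ e = ∏ e ∈ A, τ (G.color e) := by
  simp [edges, edgeWeight_coe]

theorem prod_edgeWeight_eq_zero {R : Type*} [CommRing R] (τ : Fin Λ → R) {A : Finset (Sym2 V)}
    {e : Sym2 V} (he : e ∈ A) (heG : e ∉ G.graph.edgeSet) : ∏ e ∈ A, G.edgeWeight τ e = 0 :=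
  prod_eq_zero he (G.edgeWeight_of_notMem τ heG)

variable [Fintype V]

theorem k_eq (A : Finset G.graph.edgeSet) : G.k A = comps univ (G.edges A) := by
  unfold k comps
  rw [spanning_eq, coe_univ]
  exact Nat.card_congr (SimpleGraph.induceUnivIso _).symm.connectedComponentEquiv

variable [DecidableEq V]

theorem coe_covered_edges (A : Finset G.graph.edgeSet) :
    (covered (G.edges A) : Set V) = G.cover A := by
  ext v
  rw [mem_coe, mem_covered]
  simp [edges, cover]

theorem kCov_eq (A : Finset G.graph.edgeSet) :
    G.kCov A = comps (covered (G.edges A)) (G.edges A) := by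
  unfold kCov comps
  rw [spanning_eq, coe_covered_edges]

/-- Since non-edges have weight `0`, sums over edge sets of `G` may be taken over all sets of pairs.
-/
theorem sum_edges {R : Type*} [AddCommMonoid R] [Fintype G.graph.edgeSet]
    (F : Finset (Sym2 V) → R) (hF : ∀ A, ∀ e ∈ A, e ∉ G.graph.edgeSet → F A = 0) :
    ∑ A, F (G.edges A) = ∑ A, F A := by
  classical
  refine (sum_map univ
    (Finset.mapEmbedding (Function.Embedding.subtype (· ∈ G.graph.edgeSet))).toEmbedding F).symm.trans ?_
  refine sum_subset (subset_univ _) fun A _ hA => ?_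
  by_contra hne
  refine hA (mem_map.2 ⟨A.subtype (· ∈ G.graph.edgeSet), mem_univ _, ?_⟩)
  ext e
  have := hF A e
  simp
  tauto

theorem sokal_eq :
    G.sokal = potts (G.edgeWeight fun c => X (SokalVar.v c)) (X SokalVar.q) univ := by
  classical
  unfold sokal potts
  rw [sym2_univ, powerset_univ, ← G.sum_edges]
  · simp_rw [k_eq, prod_edges]
  · intro A e he heG
    rw [prod_edgeWeight_eq_zero G _ he heG, mul_zero]

theorem xiLab_eq :
    G.xiLab = conv (coverPotts (G.edgeWeight fun c => X (XiVar.t c)) (X XiVar.x * X XiVar.z))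
      (potts (G.edgeWeight fun c => X (XiVar.t c)) (X XiVar.x)) univ := by
  classical
  unfold xiLab
  let F (A B : Finset (Sym2 V)) : MvPolynomial (XiVar Λ) ℤ :=
    if Disjoint (covered A) (covered B) then X XiVar.x ^ comps univ (A ∪ B) *
      (∏ e ∈ A ∪ B, G.edgeWeight (fun c => X (XiVar.t c)) e) * X XiVar.z ^ comps (covered B) B else 0
  have hF : ∀ A B, ∀ e ∈ A ∪ B, e ∉ G.graph.edgeSet → F A B = 0 := by
    intro A B e he heG
    simp only [F]
    rw [prod_edgeWeight_eq_zero G _ he heG, mul_zero, zero_mul, ite_self]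
  refine Eq.trans ?_ (sum_disjoint_eq_conv (G.edgeWeight fun c => X (XiVar.t c)) _ _)
  change _ = ∑ A, ∑ B, F A B
  rw [← G.sum_edges (fun A => ∑ B, F A B) fun A e he heG =>
    sum_eq_zero fun B _ => hF A B e (mem_union_left _ he) heG]
  refine sum_congr rfl fun A _ => ?_
  rw [← G.sum_edges (F (G.edges A)) fun B e he heG => hF _ B e (mem_union_right _ he) heG]
  refine sum_congr rfl fun B _ => ?_
  have hU : G.edges A ∪ G.edges B = G.edges (A ∪ B) := by
    ext e
    simp [edges, exists_or]
  have hd : Disjoint (covered (G.edges A)) (covered (G.edges B)) ↔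
      Disjoint (G.cover A) (G.cover B) := by
    rw [← disjoint_coe, coe_covered_edges, coe_covered_edges]
  simp only [F]
  rw [hU, prod_edges, ← k_eq, ← kCov_eq]
  by_cases h : Disjoint (G.cover A) (G.cover B)
  · rw [if_pos h, if_pos (hd.2 h)]
    congr!
  · rw [if_neg h, if_neg (hd.not.2 h)]

theorem isMatchingSet_iff (A : Finset G.graph.edgeSet) :
    G.IsMatchingSet A ↔ 2 * A.card = (covered (G.edges A)).card := by
  have : (G.edges A).card = A.card := card_map _
  rw [← this, two_mul_card_eq_card_covered_iff]
  · simp only [edges, IsMatchingSet, mem_map, forall_exists_index, and_imp,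
      forall_apply_eq_imp_iff₂, Function.Embedding.subtype_apply, Subtype.val_inj]
  · intro e he
    obtain ⟨e, -, rfl⟩ := mem_map.1 he
    exact G.graph.not_isDiag_of_mem_edgeSet e.2

/-- With an auxiliary variable of degree two per edge and degree one per uncovered vertex, `A` has
degree `|V|` exactly when `2|A|` equals the number of covered vertices, that is, when `A` is a
matching. -/
theorem matchingPolynomial_eq :
    G.matchingPolynomial = Polynomial.coeff (conv
      (coverPotts (G.edgeWeight fun c => Polynomial.C (X (MatchingVar.t c)) * Polynomial.X ^ 2) 1)
      (fun T => (Polynomial.C (X MatchingVar.x) * Polynomial.X) ^ T.card) univ)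
      (Fintype.card V) := by
  classical
  unfold matchingPolynomial
  rw [sum_coverPotts_mul, ← G.sum_edges, Polynomial.finsetSum_coeff]
  · refine sum_congr rfl fun A _ => ?_
    have hc : (G.cover A)ᶜ.ncard = (covered (G.edges A))ᶜ.card := by
      rw [← coe_covered_edges, ← coe_compl, Set.ncard_coe_finset]
    rw [one_pow, one_mul, prod_edges, prod_mul_distrib, prod_const, mul_pow, ← map_prod, ← map_pow,
      ← pow_mul, hc]
    have h1 := card_compl_add_card (covered (G.edges A))
    have h2 : ∀ a b : MvPolynomial (MatchingVar Λ) ℤ, ∀ m n : ℕ,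
        Polynomial.C a * Polynomial.X ^ m * (Polynomial.C b * Polynomial.X ^ n)
          = Polynomial.C (b * a) * Polynomial.X ^ (m + n) := by
      intro a b m n
      rw [map_mul, pow_add]
      ring
    rw [h2, Polynomial.coeff_C_mul, Polynomial.coeff_X_pow]
    have h3 : G.IsMatchingSet A ↔
        Fintype.card V = 2 * A.card + (covered (G.edges A))ᶜ.card := by
      rw [isMatchingSet_iff]
      omega
    by_cases hM : G.IsMatchingSet A
    · rw [if_pos hM, if_pos (h3.1 hM), mul_one]
    · rw [if_neg hM, if_neg (h3.not.1 hM), mul_zero]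
  · intro A e he heG
    rw [prod_edgeWeight_eq_zero G _ he heG, mul_zero, zero_mul]

end ColoredGraph

/-! ### Consequences of the Sokal polynomial -/

namespace ColoredGraph

open Finset VertexMatching MvPolynomial

variable {V W : Type u} {Λ : ℕ}

/-- The number of edges of colour `c` in the edge set `A`. -/
def colorCount (G : ColoredGraph V Λ) (A : Finset G.graph.edgeSet) (c : Fin Λ) : ℕ :=
  #{e ∈ A | G.color e = c}

theorem prod_color_eq {R : Type*} [CommRing R] (G : ColoredGraph V Λ) (τ : Fin Λ → R)
    (A : Finset G.graph.edgeSet) : ∏ e ∈ A, τ (G.color e) = ∏ c, τ c ^ G.colorCount A c := by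
  rw [← prod_fiberwise A G.color]
  refine prod_congr rfl fun c _ => ?_
  rw [colorCount, ← prod_const]
  exact prod_congr rfl fun e he => by rw [(mem_filter.1 he).2]

theorem card_eq_sum_colorCount (G : ColoredGraph V Λ) (A : Finset G.graph.edgeSet) :
    A.card = ∑ c, G.colorCount A c :=
  card_eq_sum_card_fiberwise fun _ _ => mem_univ _

open Classical in
theorem colorCount_compl [Fintype V] (G : ColoredGraph V Λ) (A : Finset G.graph.edgeSet)
    (c : Fin Λ) : G.colorCount Aᶜ c = G.colorCount univ c - G.colorCount A c := by
  have : G.colorCount univ c = G.colorCount A c + G.colorCount Aᶜ c := by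
    unfold colorCount
    rw [← union_compl A, filter_union, card_union_of_disjoint]
    exact disjoint_filter_filter disjoint_compl_right
  omega

/-- The exponent of the monomial of the Sokal polynomial that belongs to `A`. -/
noncomputable def sokalExponent (G : ColoredGraph V Λ) (A : Finset G.graph.edgeSet) :
    SokalVar Λ →₀ ℕ :=
  Finsupp.single SokalVar.q (G.k A) + ∑ e ∈ A, Finsupp.single (SokalVar.v (G.color e)) 1

theorem sokalExponent_q (G : ColoredGraph V Λ) (A : Finset G.graph.edgeSet) :
    G.sokalExponent A SokalVar.q = G.k A := by
  classical
  simp [sokalExponent]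

theorem sokalExponent_v (G : ColoredGraph V Λ) (A : Finset G.graph.edgeSet) (c : Fin Λ) :
    G.sokalExponent A (SokalVar.v c) = G.colorCount A c := by
  classical
  simp [sokalExponent, Finsupp.single_apply, colorCount]

open Classical in
theorem sokal_eq_sum_monomial [Fintype V] (G : ColoredGraph V Λ) :
    G.sokal = ∑ A, monomial (G.sokalExponent A) (1 : ℤ) := by
  unfold sokal
  refine sum_congr rfl fun A _ => ?_
  have : ∏ e ∈ A, X (SokalVar.v (G.color e))
      = monomial (∑ e ∈ A, Finsupp.single (SokalVar.v (G.color e)) 1) (1 : ℤ) := by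
    rw [monomial_sum_one]
    rfl
  rw [this, X_pow_eq_monomial, monomial_mul, one_mul, sokalExponent]

variable [Fintype V] [Fintype W]

/-- Each coefficient counts the edge sets with given `k` and color counts, so equal coefficients
allow these classes to be matched. -/
theorem exists_equiv_of_sokal_eq {G : ColoredGraph V Λ} {H : ColoredGraph W Λ}
    (h : G.sokal = H.sokal) :
    ∃ ψ : Finset G.graph.edgeSet ≃ Finset H.graph.edgeSet,
      (∀ A, H.k (ψ A) = G.k A) ∧ ∀ A c, H.colorCount (ψ A) c = G.colorCount A c := by
  classical
  have key : ∀ m, Nonempty ({A // G.sokalExponent A = m} ≃ {A // H.sokalExponent A = m}) := by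
    intro m
    rw [sokal_eq_sum_monomial, sokal_eq_sum_monomial] at h
    have := congrArg (coeff m) h
    simp only [coeff_sum, coeff_monomial, sum_boole, Nat.cast_inj] at this
    exact ⟨Fintype.equivOfCardEq (by simpa [Fintype.card_subtype] using this)⟩
  have hψ := Equiv.ofFiberEquiv_map fun m => (key m).some
  refine ⟨Equiv.ofFiberEquiv fun m => (key m).some, fun A => ?_, fun A c => ?_⟩
  · rw [← sokalExponent_q, ← sokalExponent_q, hψ]
  · rw [← sokalExponent_v, ← sokalExponent_v, hψ]

open Classical in
theorem colorCount_univ_eq {G : ColoredGraph V Λ} {H : ColoredGraph W Λ}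
    (ψ : Finset G.graph.edgeSet ≃ Finset H.graph.edgeSet)
    (h : ∀ A c, H.colorCount (ψ A) c = G.colorCount A c) (c : Fin Λ) :
    H.colorCount univ c = G.colorCount univ c := by
  apply le_antisymm
  · rw [← ψ.apply_symm_apply univ, h]
    exact card_le_card (filter_subset_filter _ (subset_univ _))
  · rw [← h]
    exact card_le_card (filter_subset_filter _ (subset_univ _))

open Classical in
theorem map_univ_eq_univ {G : ColoredGraph V Λ} {H : ColoredGraph W Λ}
    (ψ : Finset G.graph.edgeSet ≃ Finset H.graph.edgeSet)
    (h : ∀ A c, H.colorCount (ψ A) c = G.colorCount A c) : ψ univ = univ := by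
  refine eq_univ_of_card _ ?_
  rw [← card_univ, card_eq_sum_colorCount, card_eq_sum_colorCount]
  exact sum_congr rfl fun c _ => by rw [h, colorCount_univ_eq ψ h]

theorem normalFunction_eq_of_sokal_eq {G : ColoredGraph V Λ} {H : ColoredGraph W Λ}
    (hVW : Nat.card V = Nat.card W) (h : G.sokal = H.sokal) :
    G.normalFunction = H.normalFunction := by
  classical
  obtain ⟨ψ, hk, hc⟩ := exists_equiv_of_sokal_eq h
  have hcard : ∀ A, (ψ A).card = A.card := fun A => by
    rw [card_eq_sum_colorCount, card_eq_sum_colorCount]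
    exact sum_congr rfl fun c _ => hc A c
  have hr : ∀ A, H.rank (ψ A) = G.rank A := fun A => by
    rw [rank, rank, hk, hVW]
  unfold normalFunction
  rw [← ψ.sum_comp]
  refine sum_congr rfl fun A _ => ?_
  rw [← map_univ_eq_univ ψ hc]
  simp only [nullity, hr, hcard]
  rw [G.prod_color_eq (fun c => X (NormalVar.b c)), H.prod_color_eq (fun c => X (NormalVar.b c)),
    G.prod_color_eq (fun c => X (NormalVar.a c)), H.prod_color_eq (fun c => X (NormalVar.a c))]
  simp only [colorCount_compl, hc, colorCount_univ_eq ψ hc]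

-- Expand the product over `Y ⊆ Aᶜ`: the factors `-1` come from `Yᶜ \ A`, which is the sign in the
-- flow polynomial of `Yᶜ`.
open Classical in
theorem chainPolynomial_eq (G : ColoredGraph V Λ) :
    G.chainPolynomial = ∑ A, (1 - X ChainVar.ω) ^ G.nullity A *
      ∏ e ∈ Aᶜ, (X (ChainVar.w (G.color e)) - 1) := by
  unfold chainPolynomial flowPolynomial
  have h1 : ∀ A : Finset G.graph.edgeSet, ∏ e ∈ Aᶜ, (X (ChainVar.w (G.color e)) - 1)
      = ∑ Y, if A ⊆ Yᶜ then ((-1) ^ (Yᶜ \ A).card * ∏ e ∈ Y, X (ChainVar.w (G.color e))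
        : MvPolynomial (ChainVar Λ) ℤ) else 0 := by
    intro A
    simp_rw [sub_eq_add_neg]
    rw [prod_add, ← sum_filter]
    refine sum_congr ?_ fun Y _ => ?_
    · ext Y
      simp [subset_compl_comm]
    · rw [prod_const, mul_comm]
      congr 3
      ext e
      simp [and_comm]
  simp_rw [h1, mul_sum]
  rw [sum_comm]
  refine sum_congr rfl fun Y _ => ?_
  rw [map_sum, sum_mul]
  refine (sum_subset_zero_on_sdiff (subset_univ _) ?_ ?_)
  · intro A hA
    rw [if_neg fun h => (mem_sdiff.1 hA).2 (mem_powerset.2 h), mul_zero]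
  · intro A hA
    rw [if_pos (mem_powerset.1 hA)]
    simp only [map_mul, map_pow, map_neg, map_one, Polynomial.aeval_X]
    ring

theorem chainPolynomial_eq_of_sokal_eq {G : ColoredGraph V Λ} {H : ColoredGraph W Λ}
    (hVW : Nat.card V = Nat.card W) (h : G.sokal = H.sokal) :
    G.chainPolynomial = H.chainPolynomial := by
  classical
  obtain ⟨ψ, hk, hc⟩ := exists_equiv_of_sokal_eq h
  have hn : ∀ A, H.nullity (ψ A) = G.nullity A := fun A => by
    rw [nullity, nullity, rank, rank, hk, hVW, card_eq_sum_colorCount, card_eq_sum_colorCount]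
    simp only [hc]
  rw [chainPolynomial_eq, chainPolynomial_eq, ← ψ.sum_comp]
  refine sum_congr rfl fun A _ => ?_
  rw [hn, G.prod_color_eq (fun c => X (ChainVar.w c) - 1),
    H.prod_color_eq (fun c => X (ChainVar.w c) - 1)]
  simp only [colorCount_compl, hc, colorCount_univ_eq ψ hc]

end ColoredGraph

theorem mainTheorem4 (Λ : ℕ) :
    ColoredGraph.Reconstructible.{u, _} (Λ := Λ) (fun V [Fintype V] G => G.xiLab) ∧
    (∀ (R : Type w) [CommRing R] (x z : R) (t : Fin Λ → R),
      ColoredGraph.Reconstructible.{u, _} (Λ := Λ) (fun V [Fintype V] G => G.xiLabEval x z t)) ∧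
    ColoredGraph.Reconstructible.{u, _} (Λ := Λ) (fun V [Fintype V] G => G.sokal) ∧
    ColoredGraph.Reconstructible.{u, _} (Λ := Λ) (fun V [Fintype V] G => G.normalFunction) ∧
    ColoredGraph.Reconstructible.{u, _} (Λ := Λ) (fun V [Fintype V] G => G.chainPolynomial) ∧
    ColoredGraph.Reconstructible.{u, _} (Λ := Λ) (fun V [Fintype V] G => G.matchingPolynomial) := by
  classical
  have hxi : ColoredGraph.Reconstructible.{u, _} (Λ := Λ) (fun V [Fintype V] G => G.xiLab) := by
    intro V W _ _ G H hV hGH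
    obtain ⟨Φ, hΦ⟩ := hGH.exists_vertexMatching
    have : Nonempty V := Fintype.card_pos_iff.1 (by omega)
    simp only [ColoredGraph.xiLab_eq]
    exact ((VertexMatching.coverPotts_agree (hΦ.comp _) hV _).conv
      (VertexMatching.potts_agree (hΦ.comp _) hV _)).2
  have hsokal : ColoredGraph.Reconstructible.{u, _} (Λ := Λ) (fun V [Fintype V] G => G.sokal) := by
    intro V W _ _ G H hV hGH
    obtain ⟨Φ, hΦ⟩ := hGH.exists_vertexMatching
    simp only [ColoredGraph.sokal_eq]
    exact (VertexMatching.potts_agree (hΦ.comp _) hV _).2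
  refine ⟨hxi, ?_, hsokal, ?_, ?_, ?_⟩
  · intro R _ x z t V W _ _ G H hV hGH
    -- Evaluation uses only the integer polynomial, so zero divisors or positive characteristic in
    -- `R` do no harm.
    exact congrArg _ (hxi V W G H hV hGH)
  · intro V W _ _ G H hV hGH
    obtain ⟨σ, -⟩ := id hGH
    exact ColoredGraph.normalFunction_eq_of_sokal_eq (Nat.card_congr σ) (hsokal V W G H hV hGH)
  · intro V W _ _ G H hV hGH
    obtain ⟨σ, -⟩ := id hGH
    exact ColoredGraph.chainPolynomial_eq_of_sokal_eq (Nat.card_congr σ) (hsokal V W G H hV hGH)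
  · intro V W _ _ G H hV hGH
    obtain ⟨Φ, hΦ⟩ := hGH.exists_vertexMatching
    have : Nonempty V := Fintype.card_pos_iff.1 (by omega)
    simp only [ColoredGraph.matchingPolynomial_eq, ← Φ.card_eq]
    exact congrArg (Polynomial.coeff · _) ((VertexMatching.coverPotts_agree (hΦ.comp _) hV 1).conv
      (VertexMatching.Agree.comp_card Φ fun n =>
        (Polynomial.C (MvPolynomial.X ColoredGraph.MatchingVar.x) * Polynomial.X) ^ n)).2
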